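/- Let $M$ be a $d$-dimensional $C^2$ manifold with a $C^1$ Riemannian metric $R$, and let $f:M\to\mathbb R$ be $C^2$. Let $\varphi$ be a chart of $M$ with open image $X\subset\mathbb R^d$. For $x\in X$ write $R(x)=(R_{ij}(x))$ for the (positive definite) matrix of the metric in the coordinates $\varphi$, $f(x)$ for $f(\varphi^{-1}(x))$, and $\nabla f$, $\nabla^2 f$ for the coordinate gradient and Hessian matrix. Let $\{\alpha_k\}_{k\ge 0}$ be a sequence of positive reals with $\alpha_k\to 0$ and $\alpha_k=\Omega(1/k)$, and consider intrinsic Riemannian gradient descent in the coordinates $\varphi$, $$x_{k+1}=g(k,x_k):=x_k-\alpha_k R(x_k)^{-1}\nabla f(x_k).$$ Assume that for every $k$ the Jacobian $D_xg(k,x)$ is invertible for Lebesgue-almost every $x\in X$. A strict saddle point is a point $x^*\in X$ with $\nabla f(x^*)=0$ at which $\nabla^2 f(x^*)$ has a negative eigenvalue. Let $W^s\subset X$ be the stable set of the strict saddle points: the set of all $x_0\in X$ such that $x_k\in X$ for all $k$ and $x_k$ converges to a strict saddle point. Then $W^s$ has Lebesgue measure zero, and $\varphi^{-1}(W^s)$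 has measure zero for the measure on the chart domain induced by the metric, which in coordinates is $\sqrt{\det R(x)}\,dx$. Moreover, let $x^*$ be a strict saddle point, put $A=R(x^*)$ and $H=\nabla^2 f(x^*)$, and let $A^{1/2}$ be the positive definite square root of $A$. Then for every $k$, $g(k,x^*)=x^*$ and $D_xg(k,x^*)=I-\alpha_kA^{-1}H$; the identity $$A^{1/2}\,(A^{-1}H)\,A^{-1/2}=A^{-1/2}HA^{-1/2}$$ holds, and its right-hand side is a symmetric matrix; and $A^{-1}H$ is diagonalizable over $\mathbb R$ with at least one negative eigenvalue. -/

import Mathlib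

open Set Filter Topology MeasureTheory Asymptotics
open scoped Manifold ContDiff Gradient

noncomputable section

namespace IntrinsicGD

/-- The coordinate space `ℝ^d` with its Euclidean norm. -/
abbrev Coord (d : ℕ) := EuclideanSpace ℝ (Fin d)

/-- A `C^1` Riemannian metric on the tangent bundle of a `d`-dimensional `C^2` manifold `M`. -/
abbrev Metric (d : ℕ) (M : Type*) [TopologicalSpace M] [ChartedSpace (Coord d) M]
    [IsManifold (𝓡 d) 2 M] :=
  Bundle.ContMDiffRiemannianMetric (𝓡 d) 1 (Coord d) (fun p : M => TangentSpace (𝓡 d) p)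

section Chart

variable {d : ℕ} {M : Type*} [TopologicalSpace M] [ChartedSpace (Coord d) M]

/-- The coordinate vector field `∂/∂x_i` of the chart `φ`, at the point with coordinates `x`. -/
def coordField (φ : OpenPartialHomeomorph M (Coord d)) (i : Fin d) (x : Coord d) :
    TangentSpace (𝓡 d) (φ.symm x) :=
  mfderiv (𝓡 d) (𝓡 d) φ.symm x (EuclideanSpace.single i (1 : ℝ) : Coord d)

/-- The matrix `(R_ij)(x)` of the metric `R` in the coordinates of the chart `φ`. -/
def metricMatrix [IsManifold (𝓡 d) 2 M] (R : Metric d M)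
    (φ : OpenPartialHomeomorph M (Coord d)) (x : Coord d) : Matrix (Fin d) (Fin d) ℝ :=
  Matrix.of fun i j => R.inner (φ.symm x) (coordField φ i x) (coordField φ j x)

/-- The coordinate expression of `f` in the chart `φ` (meaningful on `φ.target`). -/
def coordFun (φ : OpenPartialHomeomorph M (Coord d)) (f : M → ℝ) : Coord d → ℝ :=
  fun x => f (φ.symm x)

/-- The matrix of second partial derivatives `∂²F/∂x_i∂x_j`. -/
def hessianMatrix (F : Coord d → ℝ) (x : Coord d) : Matrix (Fin d) (Fin d) ℝ :=
  Matrix.of fun i j =>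
    fderiv ℝ (fderiv ℝ F) x (EuclideanSpace.single i 1) (EuclideanSpace.single j 1)

/-- One step of intrinsic Riemannian gradient descent in the chart `φ` with step size `a`:
`x ↦ x - a (R^{ij})(x) ∇f(x)`, where `(R^{ij})` is the inverse of the metric matrix. -/
def step [IsManifold (𝓡 d) 2 M] (R : Metric d M) (f : M → ℝ)
    (φ : OpenPartialHomeomorph M (Coord d)) (a : ℝ) (x : Coord d) : Coord d :=
  x - a • Matrix.toEuclideanCLM (𝕜 := ℝ) (metricMatrix R φ x)⁻¹ (∇ (coordFun φ f) x)

/-- The sequence `x_0, x_1, …` with `x_{k+1} = x_k - α_k (R^{ij})(x_k) ∇f(x_k)`. -/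
def orbit [IsManifold (𝓡 d) 2 M] (R : Metric d M) (f : M → ℝ)
    (φ : OpenPartialHomeomorph M (Coord d)) (α : ℕ → ℝ) (x₀ : Coord d) : ℕ → Coord d
  | 0 => x₀
  | k + 1 => step R f φ (α k) (orbit R f φ α x₀ k)

/-- Strict saddle points of `f` in the chart `φ`, in coordinates: critical points at which the
Hessian has a negative eigenvalue. -/
def strictSaddles (f : M → ℝ) (φ : OpenPartialHomeomorph M (Coord d)) : Set (Coord d) :=
  {x | x ∈ φ.target ∧ ∇ (coordFun φ f) x = 0 ∧
    ∃ μ < 0, Module.End.HasEigenvalue (Matrix.toLin' (hessianMatrix (coordFun φ f) x)) μ}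

/-- The global stable set of the strict saddle points: the initial conditions in the coordinate
domain for which every iterate is defined (that is, the sequence never leaves the coordinate
domain) and the sequence converges to a strict saddle point. -/
def stableSet [IsManifold (𝓡 d) 2 M] (R : Metric d M) (f : M → ℝ)
    (φ : OpenPartialHomeomorph M (Coord d)) (α : ℕ → ℝ) : Set (Coord d) :=
  {x₀ | (∀ k, orbit R f φ α x₀ k ∈ φ.target) ∧
    ∃ z ∈ strictSaddles f φ, Tendsto (orbit R f φ α x₀) atTop (𝓝 z)}

/-- The measure induced by the metric `R` on the domain of the chart `φ`: in coordinates it is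
`√(det R_ij(x)) dx`. -/
def riemannianMeasure [IsManifold (𝓡 d) 2 M] [MeasurableSpace M] (R : Metric d M)
    (φ : OpenPartialHomeomorph M (Coord d)) : Measure M :=
  Measure.map φ.symm ((volume.restrict φ.target).withDensity
    fun x => ENNReal.ofReal √(metricMatrix R φ x).det)

end Chart

end IntrinsicGD

end

/-! The step map changes with time, so instead of a stable manifold for a fixed map the proof
compares two orbits trapped near the same saddle `z`. In coordinates diagonalizing `A⁻¹H`, their
difference `δ` evolves by `diag (1 - α_k l_i)` up to an error `α_k ε ‖δ‖`, by strict
differentiability. Error and expansion both carry the factor `α_k`, so once the sup norm of `δ` sits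
on an expanding coordinate (`l_i < 0`) it stays on one and grows by `1 + α_k c/2` (`cone_step`).
Since `α_k = Ω(1/k)` is not summable, `δ` would be unbounded, which trapping forbids. Differences of
trapped initial points therefore avoid an open cone around an expanding line, and a set with that
property is null (`addHaar_eq_zero_of_sub_mem`).

An orbit converging to a saddle is trapped from some time on. Steps with almost everywhere
invertible Jacobian pull null sets back to null sets (area formula), and Lindelöf leaves countably
many neighbourhoods and entry times. The induced measure is absolutely continuous in coordinates.

The linear algebra rests on `A⁻¹H` being similar to the symmetric `A^{-1/2} H A^{-1/2}`, which is
congruent to `H`. -/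

namespace IntrinsicGD

/-! ### Expanding cones and trapped orbits. -/

section Dynamics

/-- If the sup norm of `δ` is attained at an expanding coordinate, then so is that of a perturbed
diagonal image of `δ`, and the norm grows by a definite factor. -/
theorem cone_step {ι : Type*} [Fintype ι] {l : ι → ℝ} {c ε a : ℝ} {δ δ' : ι → ℝ}
    (hc : ∀ i, l i < 0 → l i ≤ -c) (ha : 0 ≤ a) (hal : ∀ j, a * l j ≤ 2)
    (hε : 2 * ε ≤ c) (hc0 : 0 < c)
    (hδ' : ∀ i, |δ' i - (1 - a * l i) * δ i| ≤ a * ε * ‖δ‖)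
    (h : ∃ i, l i < 0 ∧ ‖δ‖ ≤ |δ i|) :
    (∃ i, l i < 0 ∧ ‖δ'‖ ≤ |δ' i|) ∧ (1 + a * (c / 2)) * ‖δ‖ ≤ ‖δ'‖ := by
  obtain ⟨i, hi, hδi⟩ := h
  have hδn := norm_nonneg δ
  have haε : a * ε * ‖δ‖ ≤ a * (c / 2) * ‖δ‖ := by
    have : a * ε ≤ a * (c / 2) := mul_le_mul_of_nonneg_left (by linarith) ha
    exact mul_le_mul_of_nonneg_right this hδn
  have hlow : (1 + a * (c / 2)) * ‖δ‖ ≤ |δ' i| := by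
    have h1 : |(1 - a * l i) * δ i| - |δ' i| ≤ a * ε * ‖δ‖ := by
      refine (abs_sub_abs_le_abs_sub _ _).trans ?_
      rw [abs_sub_comm]; exact hδ' i
    have h2 : (1 + a * c) * ‖δ‖ ≤ |(1 - a * l i) * δ i| := by
      have h3 : a * c ≤ a * (-l i) := mul_le_mul_of_nonneg_left (by linarith [hc i hi]) ha
      have h4 : 0 ≤ a * c := by positivity
      rw [abs_mul, abs_of_nonneg (by linarith)]
      exact mul_le_mul (by linarith) hδi hδn (by linarith)
    linarith
  -- As `0 ≤ a * l j ≤ 2`, the factor `1 - a * l j` has modulus at most 1, so a non-expanding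
  -- coordinate grows only by the error, at most `a * (c / 2) * ‖δ‖`.
  have hstab : ∀ j, 0 ≤ l j → |δ' j| ≤ |δ' i| := by
    intro j hj
    have h1 : |δ' j| - |(1 - a * l j) * δ j| ≤ a * ε * ‖δ‖ :=
      (abs_sub_abs_le_abs_sub _ _).trans (hδ' j)
    have h2 : |(1 - a * l j) * δ j| ≤ 1 * ‖δ‖ := by
      rw [abs_mul]
      have h3 : 0 ≤ a * l j := mul_nonneg ha hj
      exact mul_le_mul (abs_le.2 ⟨by linarith [hal j], by linarith⟩) (norm_le_pi_norm δ j)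
        (abs_nonneg _) zero_le_one
    linarith
  refine ⟨?_, hlow.trans (norm_le_pi_norm δ' i)⟩
  have : Nonempty ι := ⟨i⟩
  obtain ⟨j, hj⟩ := Finite.exists_max fun j => |δ' j|
  have hnorm : ‖δ'‖ ≤ |δ' j| := (pi_norm_le_iff_of_nonneg (abs_nonneg _)).2 hj
  rcases lt_or_ge (l j) 0 with hlj | hlj
  · exact ⟨j, hlj, hnorm⟩
  · exact ⟨i, hi, hnorm.trans (hstab j hlj)⟩

/-- Bernoulli's inequality for the product of the factors `1 + α k * b`: it turns divergence of the
sum of steps into unbounded growth. -/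
theorem growth_of_step {u α : ℕ → ℝ} {b : ℝ} (hb : 0 ≤ b) (hα : ∀ k, 0 ≤ α k) (hu : 0 ≤ u 0)
    (h : ∀ k, (1 + α k * b) * u k ≤ u (k + 1)) (n : ℕ) :
    (1 + b * ∑ k ∈ Finset.range n, α k) * u 0 ≤ u n := by
  have hmono : ∀ n, u 0 ≤ u n := by
    intro n
    induction n with
    | zero => exact le_rfl
    | succ n ih =>
      have h1 : 0 ≤ α n * b * u n := mul_nonneg (mul_nonneg (hα n) hb) (hu.trans ih)
      nlinarith [h n]
  induction n with
  | zero => simp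
  | succ n ih =>
    rw [Finset.sum_range_succ]
    have h1 : α n * b * u 0 ≤ α n * b * u n :=
      mul_le_mul_of_nonneg_left (hmono n) (mul_nonneg (hα n) hb)
    nlinarith [h n]

/-- A set whose difference set lies in a closed set meeting a line only at the origin is null. -/
theorem addHaar_eq_zero_of_sub_mem {E : Type*} [NormedAddCommGroup E] [NormedSpace ℝ E]
    [MeasurableSpace E] [BorelSpace E] [FiniteDimensional ℝ E]
    (μ : Measure E) [μ.IsAddHaarMeasure] {T C : Set E} {e : E} (hC : IsClosed C)
    (he : ∀ t : ℝ, t • e ∈ C → t = 0) (hT : ∀ x ∈ T, ∀ y ∈ T, x - y ∈ C) : μ T = 0 := by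
  have hcl : ∀ x ∈ closure T, ∀ y ∈ closure T, x - y ∈ C := by
    intro x hx y hy
    have h := map_mem_closure₂ (f := fun x y : E => x - y) continuous_sub hx hy hT
    rwa [hC.closure_eq] at h
  refine measure_mono_null subset_closure ?_
  -- The closure is measurable, and two of its translates along the bounded sequence `e / (n + 1)`
  -- can meet only if a nonzero multiple of `e` lies in `C`.
  refine Measure.addHaar_eq_zero_of_disjoint_translates μ
    (fun n : ℕ => (1 / ((n : ℝ) + 1)) • e) ?_ ?_ isClosed_closure.measurableSet
  · refine (Metric.isBounded_closedBall (x := (0 : E)) (r := ‖e‖)).subset ?_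
    rintro _ ⟨n, rfl⟩
    simp only [mem_closedBall_zero_iff, norm_smul]
    have h1 : ‖1 / ((n : ℝ) + 1)‖ ≤ 1 := by
      rw [Real.norm_of_nonneg (by positivity), div_le_one (by positivity)]
      linarith [n.cast_nonneg (α := ℝ)]
    exact mul_le_of_le_one_left (norm_nonneg e) h1
  · intro n k hnk
    refine Set.disjoint_left.2 fun p hp hp' => hnk ?_
    simp only [singleton_add, mem_image] at hp hp'
    obtain ⟨x, hx, rfl⟩ := hp
    obtain ⟨y, hy, hxy⟩ := hp'
    have h1 : (1 / ((n : ℝ) + 1) - 1 / ((k : ℝ) + 1)) • e = y - x := by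
      rw [sub_smul, sub_eq_sub_iff_add_eq_add, ← hxy, add_comm]
    have h2 := he _ (h1 ▸ hcl y hy x hx)
    have h3 : ((n : ℝ) + 1) = k + 1 := by
      have := sub_eq_zero.1 h2
      rwa [one_div, one_div, inv_inj] at this
    exact_mod_cast add_right_cancel h3

/-- Near a zero of a vector field whose linearization is diagonalizable with a negative
eigenvalue, the initial points of the orbits of `x ↦ x - α_k G(x)` (with small non-summable steps)
that never leave a small neighbourhood form a null set. -/
theorem exists_nhds_trapped_null {E ι : Type*} [NormedAddCommGroup E] [NormedSpace ℝ E]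
    [MeasurableSpace E] [BorelSpace E] [FiniteDimensional ℝ E] [Fintype ι]
    (μ : Measure E) [μ.IsAddHaarMeasure]
    {G : E → E} {G' : E →L[ℝ] E} {z : E} (hG : HasStrictFDerivAt G G' z)
    (L : E ≃L[ℝ] (ι → ℝ)) (l : ι → ℝ) (hL : ∀ v i, L (G' v) i = l i * L v i)
    {i₀ : ι} (hi₀ : l i₀ < 0)
    {α : ℕ → ℝ} (hα_pos : ∀ k, 0 < α k) (hα_zero : Tendsto α atTop (𝓝 0))
    (hα_sum : ¬ Summable α) :
    ∃ V ∈ 𝓝 z, ∃ K, ∀ m ≥ K,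
      μ {y | ∃ x : ℕ → E, x 0 = y ∧
        ∀ k, x k ∈ V ∧ x (k + 1) = x k - α (m + k) • G (x k)} = 0 := by
  classical
  obtain ⟨c, hc0, hc⟩ : ∃ c > 0, ∀ i, l i < 0 → l i ≤ -c := by
    obtain ⟨i, hi, hmax⟩ := (Finset.univ.filter fun i => l i < 0).exists_max_image l
      ⟨i₀, by simpa using hi₀⟩
    refine ⟨-l i, by simpa using hi, fun j hj => ?_⟩
    simpa using hmax j (by simpa using hj)
  obtain ⟨K, hK⟩ : ∃ K, ∀ k ≥ K, ∀ j, α k * l j ≤ 2 := by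
    have h : ∀ᶠ k in atTop, ∀ j, α k * l j ≤ 2 := by
      refine eventually_all.2 fun j => ?_
      have : Tendsto (fun k => α k * l j) atTop (𝓝 (0 * l j)) := hα_zero.mul_const _
      rw [zero_mul] at this
      exact (this.eventually_lt_const two_pos).mono fun _ h => h.le
    exact eventually_atTop.1 h
  -- Strict differentiability controls `G` at two moving points; the tolerance `c / 2` is the `ε` of
  -- `cone_step`.
  have hsmall : ∀ᶠ p : E × E in 𝓝 (z, z),
      ‖L (G p.1 - G p.2 - G' (p.1 - p.2))‖ ≤ c / 2 * ‖L (p.1 - p.2)‖ := by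
    have h1 : (fun p : E × E => L (G p.1 - G p.2 - G' (p.1 - p.2))) =o[𝓝 (z, z)]
        fun p => L (p.1 - p.2) :=
      ((L : E →L[ℝ] (ι → ℝ)).isBigO_comp _ _).trans_isLittleO
        (hG.isLittleO.trans_isBigO (L.isBigO_comp_rev _ _))
    exact h1.def (by positivity)
  obtain ⟨V₀, hV₀, hV₀small⟩ : ∃ V₀ ∈ 𝓝 z, ∀ x ∈ V₀, ∀ y ∈ V₀,
      ‖L (G x - G y - G' (x - y))‖ ≤ c / 2 * ‖L (x - y)‖ := by
    rw [nhds_prod_eq] at hsmall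
    obtain ⟨V, hV, h⟩ := mem_prod_same_iff.1 hsmall
    exact ⟨V, hV, fun x hx y hy => h (mk_mem_prod hx hy)⟩
  -- The unit ball only serves to bound the difference of two trapped orbits, by 2.
  refine ⟨V₀ ∩ Metric.ball z 1, inter_mem hV₀ (Metric.ball_mem_nhds _ one_pos), K,
    fun m hm => ?_⟩
  -- Outside `C`, coordinate `i₀` strictly beats every non-expanding one, so the sup norm sits on
  -- some expanding coordinate. The origin is listed separately for the case where all coordinates
  -- expand.
  set C : Set E := {δ | δ = 0 ∨ ∃ j, 0 ≤ l j ∧ |L δ i₀| ≤ |L δ j|} with hC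
  have hLc : ∀ j, Continuous fun δ => L δ j := fun j => (continuous_apply j).comp L.continuous
  have hCcl : IsClosed C := by
    have : C = {0} ∪ ⋃ j ∈ {j | 0 ≤ l j}, {δ | |L δ i₀| ≤ |L δ j|} := by
      ext δ; simp [hC]
    rw [this]
    exact isClosed_singleton.union ((Set.toFinite _).isClosed_biUnion fun j _ =>
      isClosed_le (hLc i₀).abs (hLc j).abs)
  refine addHaar_eq_zero_of_sub_mem μ (e := L.symm (Pi.single i₀ 1)) hCcl ?_ ?_
  · rintro t (h | ⟨j, hj, h⟩)
    · have := congrArg (fun v => L v i₀) h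
      simpa using this
    · have hne : j ≠ i₀ := by rintro rfl; exact absurd hj (not_le.2 hi₀)
      simpa [hne] using h
  · rintro _ ⟨x, rfl, hx⟩ _ ⟨y, rfl, hy⟩
    by_contra hnot
    have hne : x 0 - y 0 ≠ 0 := fun h => hnot (Or.inl h)
    have hdom : ∀ j, 0 ≤ l j → |L (x 0 - y 0) j| < |L (x 0 - y 0) i₀| := fun j hj =>
      not_le.1 fun h => hnot (Or.inr ⟨j, hj, h⟩)
    have hstart : ∃ i, l i < 0 ∧ ‖L (x 0 - y 0)‖ ≤ |L (x 0 - y 0) i| := by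
      have : Nonempty ι := ⟨i₀⟩
      obtain ⟨j, hj⟩ := Finite.exists_max fun j => |L (x 0 - y 0) j|
      refine ⟨j, ?_, (pi_norm_le_iff_of_nonneg (abs_nonneg _)).2 hj⟩
      by_contra hlj
      exact absurd (hj i₀) (not_le.2 (hdom j (not_lt.1 hlj)))
    have hstep : ∀ k, (∃ i, l i < 0 ∧ ‖L (x k - y k)‖ ≤ |L (x k - y k) i|) →
        (∃ i, l i < 0 ∧ ‖L (x (k + 1) - y (k + 1))‖ ≤ |L (x (k + 1) - y (k + 1)) i|) ∧
        (1 + α (m + k) * (c / 2)) * ‖L (x k - y k)‖ ≤ ‖L (x (k + 1) - y (k + 1))‖ := by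
      intro k
      refine cone_step (ε := c / 2) hc (hα_pos _).le (hK _ (by omega)) (by linarith) hc0 ?_
      intro i
      have hb := (norm_le_pi_norm _ i).trans (hV₀small _ (hx k).1.1 _ (hy k).1.1)
      have heq : L (x (k + 1) - y (k + 1)) i - (1 - α (m + k) * l i) * L (x k - y k) i =
          -(α (m + k) * L (G (x k) - G (y k) - G' (x k - y k)) i) := by
        rw [(hx k).2, (hy k).2]
        have := hL (x k - y k) i
        simp only [map_sub, map_smul, Pi.sub_apply, Pi.smul_apply, smul_eq_mul] at this ⊢
        linear_combination (-α (m + k)) * this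
      rw [heq, abs_neg, abs_mul, abs_of_pos (hα_pos _), mul_assoc]
      exact mul_le_mul_of_nonneg_left hb (hα_pos _).le
    have hall : ∀ k, ∃ i, l i < 0 ∧ ‖L (x k - y k)‖ ≤ |L (x k - y k) i| := fun k => by
      induction k with
      | zero => exact hstart
      | succ k ih => exact (hstep k ih).1
    have hgrow := growth_of_step (u := fun k => ‖L (x k - y k)‖) (α := fun k => α (m + k))
      (b := c / 2) (by positivity) (fun k => (hα_pos _).le) (norm_nonneg _)
      fun k => (hstep k (hall k)).2
    have hpos : 0 < ‖L (x 0 - y 0)‖ := norm_pos_iff.2 fun h => hne (by simpa using congrArg L.symm h)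
    have hdiv : Tendsto (fun n => ∑ k ∈ Finset.range n, α (m + k)) atTop atTop := by
      refine (not_summable_iff_tendsto_nat_atTop_of_nonneg fun k => (hα_pos _).le).1 fun h => ?_
      refine hα_sum ((summable_nat_add_iff m).1 ?_)
      simpa only [add_comm] using h
    have hdiv' : Tendsto (fun n => (1 + c / 2 * ∑ k ∈ Finset.range n, α (m + k)) *
        ‖L (x 0 - y 0)‖) atTop atTop :=
      (tendsto_atTop_add_const_left _ _ (hdiv.const_mul_atTop (by positivity))).atTop_mul_const hpos
    obtain ⟨n, hn⟩ := (hdiv'.eventually_gt_atTop (‖(L : E →L[ℝ] (ι → ℝ))‖ * 2)).exists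
    have hbd : ‖L (x n - y n)‖ ≤ ‖(L : E →L[ℝ] (ι → ℝ))‖ * 2 := by
      refine ((L : E →L[ℝ] (ι → ℝ)).le_opNorm _).trans ?_
      refine mul_le_mul_of_nonneg_left ?_ (norm_nonneg _)
      have h1 := mem_ball_iff_norm.1 (hx n).1.2
      have h2 := mem_ball_iff_norm.1 (hy n).1.2
      have h3 : x n - y n = (x n - z) - (y n - z) := by abel
      rw [h3]
      exact (norm_sub_le _ _).trans (by linarith)
    exact absurd (hgrow n) (not_le.2 (hbd.trans_lt hn))

end Dynamics

/-! ### Preimages of null sets. -/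

section NullPreimage

variable {E : Type*} [NormedAddCommGroup E] [NormedSpace ℝ E] [FiniteDimensional ℝ E]

theorem exists_open_injOn_of_det_ne_zero {g : E → E} {x : E} (hg : ContDiffAt ℝ 1 g x)
    (hdet : (fderiv ℝ g x).det ≠ 0) : ∃ V, IsOpen V ∧ x ∈ V ∧ InjOn g V := by
  set e := (fderiv ℝ g x).toContinuousLinearEquivOfDetNeZero hdet
  have h : HasStrictFDerivAt g (e : E →L[ℝ] E) x := by
    simpa [e] using hg.hasStrictFDerivAt one_ne_zero
  exact ⟨_, (h.toOpenPartialHomeomorph g).open_source, h.mem_toOpenPartialHomeomorph_source,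
    (h.toOpenPartialHomeomorph g).injOn⟩

variable [MeasurableSpace E] [BorelSpace E] (μ : Measure E) [μ.IsAddHaarMeasure]

/-- A `C^1` map with almost everywhere invertible derivative pulls null sets back to null sets. -/
theorem addHaar_preimage_eq_zero {U N : Set E} (hU : IsOpen U) {g : E → E}
    (hg : ∀ x ∈ U, ContDiffAt ℝ 1 g x)
    (hdet : ∀ᵐ x ∂(μ.restrict U), (fderiv ℝ g x).det ≠ 0) (hN : μ N = 0) :
    μ (U ∩ g ⁻¹' N) = 0 := by
  classical
  set Z : Set E := {x | x ∈ U ∧ (fderiv ℝ g x).det = 0}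
  have hZ : μ Z = 0 := by
    rw [ae_restrict_iff' hU.measurableSet] at hdet
    refine measure_mono_null ?_ (ae_iff.1 hdet)
    rintro x ⟨hx, h⟩
    simp [hx, h]
  set N' := toMeasurable μ N
  have hN' : μ N' = 0 := by rw [measure_toMeasurable, hN]
  have hnhds : ∀ x ∈ U \ Z, ∃ V, IsOpen V ∧ x ∈ V ∧ V ⊆ U ∧ InjOn g V := by
    rintro x ⟨hx, hxZ⟩
    obtain ⟨V, hV, hxV, hinj⟩ := exists_open_injOn_of_det_ne_zero (hg x hx)
      fun h => hxZ ⟨hx, h⟩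
    exact ⟨V ∩ U, hV.inter hU, ⟨hxV, hx⟩, inter_subset_right, hinj.mono inter_subset_left⟩
  choose! V hVo hxV hVU hVinj using hnhds
  obtain ⟨t, htsub, htc, hcov⟩ := TopologicalSpace.countable_cover_nhdsWithin (f := V)
    fun x hx => mem_nhdsWithin_of_mem_nhds ((hVo x hx).mem_nhds (hxV x hx))
  have hlocal : ∀ x ∈ t, μ ((V x ∩ g ⁻¹' N') \ Z) = 0 := by
    intro x hx
    have hsub := hVU x (htsub hx)
    have hcont : ContinuousOn g (V x) := fun y hy =>
      (hg y (hsub hy)).continuousAt.continuousWithinAt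
    have hmeas : MeasurableSet (V x ∩ g ⁻¹' N') := by
      -- `g` is only controlled on `U`; extending it by zero off `V x` gives a globally measurable
      -- map.
      have h := hcont.measurable_piecewise (g := fun _ => (0 : E)) continuousOn_const
        (hVo x (htsub hx)).measurableSet
      have h2 : V x ∩ g ⁻¹' N' = V x ∩ (V x).piecewise g (fun _ => 0) ⁻¹' N' := by
        ext y
        constructor
        · rintro ⟨hy, h⟩; exact ⟨hy, by simpa [hy] using h⟩
        · rintro ⟨hy, h⟩; exact ⟨hy, by simpa [hy] using h⟩
      rw [h2]
      exact (hVo x (htsub hx)).measurableSet.inter (h (measurableSet_toMeasurable _ _))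
    -- The image lies in the null set `N'`, so the Jacobian integrates to zero over the piece; being
    -- nonzero off `Z`, it leaves only a null set there.
    have harea := lintegral_abs_det_fderiv_eq_addHaar_image μ hmeas (f' := fderiv ℝ g)
      (fun y hy => ((hg y (hsub hy.1)).differentiableAt one_ne_zero).hasFDerivAt.hasFDerivWithinAt)
      ((hVinj x (htsub hx)).mono inter_subset_left)
    have hzero : μ (g '' (V x ∩ g ⁻¹' N')) = 0 := by
      refine measure_mono_null ?_ hN'
      rintro _ ⟨y, hy, rfl⟩
      exact hy.2
    rw [hzero] at harea
    have hcontdet : ContinuousOn (fun y => ENNReal.ofReal |(fderiv ℝ g y).det|) (V x) := by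
      refine ENNReal.continuous_ofReal.comp_continuousOn (ContinuousOn.abs ?_)
      refine ContinuousLinearMap.continuous_det.comp_continuousOn ?_
      intro y hy
      exact ((hg y (hsub hy)).continuousAt_fderiv one_ne_zero).continuousWithinAt
    have hae : AEMeasurable (fun y => ENNReal.ofReal |(fderiv ℝ g y).det|)
        (μ.restrict (V x ∩ g ⁻¹' N')) :=
      (hcontdet.aemeasurable (hVo x (htsub hx)).measurableSet).mono_measure
        (Measure.restrict_mono inter_subset_left le_rfl)
    have h0 := (lintegral_eq_zero_iff' hae).1 harea
    have h1 := (ae_restrict_iff' hmeas).1 h0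
    refine measure_mono_null ?_ (ae_iff.1 h1)
    rintro y ⟨hy, hyZ⟩
    have : (fderiv ℝ g y).det ≠ 0 := fun h => hyZ ⟨hsub hy.1, h⟩
    simpa [hy.1, this] using hy.2
  refine measure_mono_null (t := Z ∪ ⋃ x ∈ t, (V x ∩ g ⁻¹' N') \ Z) ?_
    (measure_union_null hZ ((measure_biUnion_null_iff htc).2 hlocal))
  rintro y ⟨hyU, hyN⟩
  by_cases hyZ : y ∈ Z
  · exact Or.inl hyZ
  · refine Or.inr ?_
    obtain ⟨x, hx, hyx⟩ := mem_iUnion₂.1 (hcov ⟨hyU, hyZ⟩)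
    exact mem_iUnion₂.2 ⟨x, hx, ⟨hyx, subset_toMeasurable _ _ hyN⟩, hyZ⟩

end NullPreimage

/-! ### Diagonalizing `A⁻¹H`. -/

section LinearAlgebra

open scoped MatrixOrder in
theorem exists_posDef_sqrt {n : Type*} [Fintype n] [DecidableEq n] {A : Matrix n n ℝ}
    (hA : A.PosDef) : ∃ S : Matrix n n ℝ, S.PosDef ∧ S * S = A := by
  refine ⟨CFC.sqrt A, ?_, CFC.sqrt_mul_sqrt_self A hA.posSemidef.nonneg⟩
  refine (Matrix.nonneg_iff_posSemidef.1 (CFC.sqrt_nonneg A)).posDef_iff_isUnit.2 ?_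
  have h := CFC.sqrt_mul_sqrt_self A hA.posSemidef.nonneg
  have hu : IsUnit (CFC.sqrt A * CFC.sqrt A) := by rw [h]; exact hA.isUnit
  exact isUnit_of_mul_isUnit_left hu

theorem conj_sqrt_mul_inv {n : Type*} [Fintype n] [DecidableEq n] {A S H : Matrix n n ℝ}
    (hS : S.PosDef) (hSA : S * S = A) : S * (A⁻¹ * H) * S⁻¹ = S⁻¹ * H * S⁻¹ := by
  have hdet : IsUnit S.det := (Matrix.isUnit_iff_isUnit_det S).1 hS.isUnit
  rw [← hSA, Matrix.mul_inv_rev, ← mul_assoc, ← mul_assoc, Matrix.mul_nonsing_inv _ hdet, one_mul]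

theorem isSymm_inv_mul_mul_inv {n : Type*} [Fintype n] [DecidableEq n] {S H : Matrix n n ℝ}
    (hS : S.IsSymm) (hH : H.IsSymm) : (S⁻¹ * H * S⁻¹).IsSymm := by
  rw [Matrix.IsSymm, Matrix.transpose_mul, Matrix.transpose_mul, Matrix.transpose_nonsing_inv,
    hS.eq, hH.eq, mul_assoc]

/-- The product of the inverse of a positive definite matrix and a symmetric matrix with a negative
eigenvalue is diagonalizable over `ℝ` with a negative eigenvalue. -/
theorem exists_diagonalization_inv_mul {n : Type*} [Fintype n] [DecidableEq n]
    {A S H : Matrix n n ℝ} (hS : S.PosDef) (hSA : S * S = A) (hH : H.IsSymm)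
    (hneg : ∃ μ < 0, Module.End.HasEigenvalue (Matrix.toLin' H) μ) :
    ∃ (Q : Matrix n n ℝ) (l : n → ℝ),
      IsUnit Q.det ∧ Q * (A⁻¹ * H) * Q⁻¹ = Matrix.diagonal l ∧ ∃ i, l i < 0 := by
  have hdet : IsUnit S.det := (Matrix.isUnit_iff_isUnit_det S).1 hS.isUnit
  have hSsymm : S.IsSymm := by
    simpa [Matrix.IsHermitian, Matrix.IsSymm] using hS.isHermitian
  have hB : (S⁻¹ * H * S⁻¹).IsHermitian := by
    rw [Matrix.IsHermitian, Matrix.conjTranspose_eq_transpose_of_trivial]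
    exact isSymm_inv_mul_mul_inv hSsymm hH
  set U : Matrix n n ℝ := (hB.eigenvectorUnitary : Matrix n n ℝ)
  have hUU : star U * U = 1 := Unitary.coe_star_mul_self _
  have hspec : S⁻¹ * H * S⁻¹ = U * Matrix.diagonal hB.eigenvalues * star U := by
    have := hB.spectral_theorem
    simpa [Unitary.conjStarAlgAut_apply] using this
  have hQ : (star U * S)⁻¹ = S⁻¹ * U := by
    rw [Matrix.mul_inv_rev, Matrix.inv_eq_right_inv hUU]
  refine ⟨star U * S, hB.eigenvalues, ?_, ?_, ?_⟩
  · rw [Matrix.det_mul]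
    exact (Matrix.isUnit_det_of_right_inverse hUU).mul hdet
  · rw [hQ]
    calc star U * S * (A⁻¹ * H) * (S⁻¹ * U) = star U * (S * (A⁻¹ * H) * S⁻¹) * U := by
          simp only [mul_assoc]
      _ = star U * (U * Matrix.diagonal hB.eigenvalues * star U) * U := by
          rw [conj_sqrt_mul_inv hS hSA, ← hspec]
      _ = (star U * U) * Matrix.diagonal hB.eigenvalues * (star U * U) := by
          simp only [mul_assoc]
      _ = _ := by rw [hUU, one_mul, mul_one]
  -- Sylvester's law of inertia in weak form: nonnegative eigenvalues would make `S⁻¹HS⁻¹`, hence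
  -- its congruent `H`, positive semidefinite.
  · by_contra! hnn
    have hpsd : (S⁻¹ * H * S⁻¹).PosSemidef := hB.posSemidef_iff_eigenvalues_nonneg.2 hnn
    have hHpsd : H.PosSemidef := by
      have h := hpsd.mul_mul_conjTranspose_same S
      rw [hS.isHermitian.eq] at h
      have h2 : S * (S⁻¹ * H * S⁻¹) * S = H := by
        rw [← mul_assoc, ← mul_assoc, Matrix.mul_nonsing_inv _ hdet, one_mul, mul_assoc,
          Matrix.nonsing_inv_mul _ hdet, mul_one]
      rwa [h2] at h
    obtain ⟨ν, hν, hev⟩ := hneg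
    obtain ⟨v, hv⟩ := hev.exists_hasEigenvector
    have h1 := hHpsd.dotProduct_mulVec_nonneg v
    have h2 : H.mulVec v = ν • v := by simpa using hv.apply_eq_smul
    rw [h2, dotProduct_smul, star_trivial, smul_eq_mul] at h1
    have h3 : 0 < v ⬝ᵥ v := by
      simpa using Matrix.dotProduct_star_self_pos_iff.2 hv.2
    nlinarith

/-- The coordinate change by an invertible matrix, from Euclidean space to `Fin d → ℝ`. -/
noncomputable def matrixCoords {d : ℕ} (Q : Matrix (Fin d) (Fin d) ℝ) (hQ : IsUnit Q.det) :
    Coord d ≃L[ℝ] (Fin d → ℝ) :=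
  (EuclideanSpace.equiv (Fin d) ℝ).trans
    (Matrix.toLinearEquiv' Q (Q.invertibleOfIsUnitDet hQ)).toContinuousLinearEquiv

theorem matrixCoords_apply {d : ℕ} (Q : Matrix (Fin d) (Fin d) ℝ) (hQ : IsUnit Q.det)
    (v : Coord d) : matrixCoords Q hQ v = Q.mulVec v.ofLp := by
  rfl

theorem matrixCoords_toEuclideanCLM {d : ℕ} {Q B : Matrix (Fin d) (Fin d) ℝ} {l : Fin d → ℝ}
    (hQ : IsUnit Q.det) (h : Q * B * Q⁻¹ = Matrix.diagonal l) (v : Coord d) (i : Fin d) :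
    matrixCoords Q hQ (Matrix.toEuclideanCLM (𝕜 := ℝ) B v) i = l i * matrixCoords Q hQ v i := by
  have h1 : Q * B = Matrix.diagonal l * Q := by
    rw [← h, mul_assoc, Matrix.nonsing_inv_mul _ hQ, mul_one]
  rw [matrixCoords_apply, matrixCoords_apply, Matrix.ofLp_toEuclideanCLM, Matrix.mulVec_mulVec, h1,
    ← Matrix.mulVec_mulVec, Matrix.mulVec_diagonal]

end LinearAlgebra

theorem eq_sum_smul_single {d : ℕ} (v : Coord d) :
    v = ∑ j, v j • (EuclideanSpace.single j (1 : ℝ) : Coord d) := by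
  ext j
  simp [Finset.sum_apply, Pi.single_apply]

/-! ### Regularity and linearization in a chart. -/

section Coordinates

variable {d : ℕ} {M : Type*} [TopologicalSpace M] [ChartedSpace (Coord d) M]
  {φ : OpenPartialHomeomorph M (Coord d)}

theorem contMDiffAt_symm (hφ : φ ∈ IsManifold.maximalAtlas (𝓡 d) 2 M) {x : Coord d}
    (hx : x ∈ φ.target) : ContMDiffAt (𝓡 d) (𝓡 d) 2 φ.symm x :=
  (contMDiffOn_symm_of_mem_maximalAtlas hφ).contMDiffAt (φ.open_target.mem_nhds hx)

theorem mdifferentiable_of_mem_maximalAtlas (hφ : φ ∈ IsManifold.maximalAtlas (𝓡 d) 2 M) :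
    φ.MDifferentiable (𝓡 d) (𝓡 d) :=
  ⟨(contMDiffOn_of_mem_maximalAtlas hφ).mdifferentiableOn two_ne_zero,
    (contMDiffOn_symm_of_mem_maximalAtlas hφ).mdifferentiableOn two_ne_zero⟩

theorem contDiffAt_coordFun (hφ : φ ∈ IsManifold.maximalAtlas (𝓡 d) 2 M) {f : M → ℝ}
    (hf : ContMDiff (𝓡 d) 𝓘(ℝ, ℝ) 2 f) {x : Coord d} (hx : x ∈ φ.target) :
    ContDiffAt ℝ 2 (coordFun φ f) x :=
  contMDiffAt_iff_contDiffAt.1 (hf.contMDiffAt.comp x (contMDiffAt_symm hφ hx))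

variable [IsManifold (𝓡 d) 2 M]

/-- The field is the tangent map of the `C^2` map `φ.symm` along a constant section, which costs one
derivative. -/
theorem contMDiffAt_coordField (hφ : φ ∈ IsManifold.maximalAtlas (𝓡 d) 2 M) (i : Fin d)
    {x : Coord d} (hx : x ∈ φ.target) :
    ContMDiffAt (𝓡 d) (𝓡 d).tangent 1
      (fun y => (⟨φ.symm y, coordField φ i y⟩ : TangentBundle (𝓡 d) M)) x := by
  have h1 : ContMDiffAt (𝓡 d) (𝓡 d).tangent 1
      (fun y : Coord d => (⟨y, (EuclideanSpace.single i (1 : ℝ) : Coord d)⟩ :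
        TangentBundle (𝓡 d) (Coord d))) x :=
    contMDiffAt_vectorSpace_iff_contDiffAt.2 contDiffAt_const
  have h2 := (contMDiffOn_symm_of_mem_maximalAtlas hφ).contMDiffOn_tangentMapWithin (m := 1)
    (by norm_num) φ.open_target.uniqueMDiffOn
  have h3 := (h2.contMDiffAt (x := ⟨x, (EuclideanSpace.single i (1 : ℝ) : Coord d)⟩)
    ((φ.open_target.preimage (FiberBundle.continuous_proj _ _)).mem_nhds hx)).comp x h1
  refine h3.congr_of_eventuallyEq ?_
  filter_upwards [φ.open_target.mem_nhds hx] with y hy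
  simp only [Function.comp, tangentMapWithin, coordField,
    mfderivWithin_of_isOpen φ.open_target hy]

theorem contDiffAt_metricMatrix (R : Metric d M) (hφ : φ ∈ IsManifold.maximalAtlas (𝓡 d) 2 M)
    (i j : Fin d) {x : Coord d} (hx : x ∈ φ.target) :
    ContDiffAt ℝ 1 (fun y => metricMatrix R φ y i j) x := by
  have h : ContMDiffAt (𝓡 d) ((𝓡 d).prod 𝓘(ℝ)) 1
      (fun y => Bundle.TotalSpace.mk' ℝ (E := Bundle.Trivial M ℝ) (φ.symm y)
        (R.inner (φ.symm y) (coordField φ i y) (coordField φ j y))) x := by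
    apply ContMDiffAt.clm_bundle_apply₂ (F₁ := Coord d) (F₂ := Coord d)
    · exact ContMDiffAt.comp x R.contMDiff.contMDiffAt
        ((contMDiffAt_symm hφ hx).of_le (by norm_num))
    · exact contMDiffAt_coordField hφ i hx
    · exact contMDiffAt_coordField hφ j hx
  simp only [Bundle.contMDiffAt_totalSpace] at h
  exact contMDiffAt_iff_contDiffAt.1 h.2

theorem posDef_metricMatrix (R : Metric d M) (hφ : φ ∈ IsManifold.maximalAtlas (𝓡 d) 2 M)
    {x : Coord d} (hx : x ∈ φ.target) : (metricMatrix R φ x).PosDef := by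
  set D : Coord d →L[ℝ] TangentSpace (𝓡 d) (φ.symm x) := mfderiv (𝓡 d) (𝓡 d) φ.symm x
  have hinj : Function.Injective D :=
    (mdifferentiable_of_mem_maximalAtlas hφ).symm.mfderiv_injective hx
  refine Matrix.PosDef.of_dotProduct_mulVec_pos ?_ ?_
  · ext i j
    simp [metricMatrix, R.symm]
  · intro v hv
    set w : Coord d := WithLp.toLp 2 v
    have hw : w = ∑ i, v i • (EuclideanSpace.single i (1 : ℝ) : Coord d) :=
      eq_sum_smul_single w
    have hDw : D w = ∑ i, v i • coordField φ i x := by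
      rw [hw, map_sum]
      simp only [map_smul]
      rfl
    have hne : D w ≠ 0 := fun h => hv (by
      have : w = 0 := hinj (h.trans (map_zero D).symm)
      exact (WithLp.toLp_eq_zero 2).1 this)
    have hpos := R.pos (φ.symm x) (D w) hne
    have heq : R.inner (φ.symm x) (D w) (D w) =
        star v ⬝ᵥ (metricMatrix R φ x).mulVec v := by
      rw [hDw]
      simp only [map_sum, map_smul, _root_.sum_apply, _root_.smul_apply, dotProduct,
        Matrix.mulVec, metricMatrix, Matrix.of_apply, smul_eq_mul, star_trivial, Finset.mul_sum]
      rw [Finset.sum_comm]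
      refine Finset.sum_congr rfl fun i _ => Finset.sum_congr rfl fun j _ => ?_
      ring
    rwa [heq] at hpos

theorem contDiffAt_toEuclideanCLM_inv_metricMatrix (R : Metric d M)
    (hφ : φ ∈ IsManifold.maximalAtlas (𝓡 d) 2 M) {x : Coord d} (hx : x ∈ φ.target) :
    ContDiffAt ℝ 1 (fun y => Matrix.toEuclideanCLM (𝕜 := ℝ) (metricMatrix R φ y)⁻¹) x := by
  have h1 : ContDiffAt ℝ 1 (fun y => Matrix.toEuclideanCLM (𝕜 := ℝ) (metricMatrix R φ y)) x := by
    have : (fun y => Matrix.toEuclideanCLM (𝕜 := ℝ) (metricMatrix R φ y)) = fun y =>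
        ∑ i, ∑ j, metricMatrix R φ y i j •
          Matrix.toEuclideanCLM (𝕜 := ℝ) (Matrix.single i j (1 : ℝ)) := by
      ext1 y
      conv_lhs => rw [Matrix.matrix_eq_sum_single (metricMatrix R φ y)]
      simp only [map_sum, ← map_smul, Matrix.smul_single, smul_eq_mul, mul_one]
    rw [this]
    exact ContDiffAt.sum fun i _ => ContDiffAt.sum fun j _ =>
      (contDiffAt_metricMatrix R hφ i j hx).smul contDiffAt_const
  -- Inversion is smooth at units of the normed algebra of operators. The identity includes singular
  -- `A`, where both sides are zero by convention.
  have hinv : ∀ A : Matrix (Fin d) (Fin d) ℝ, Matrix.toEuclideanCLM (𝕜 := ℝ) A⁻¹ =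
      Ring.inverse (Matrix.toEuclideanCLM (𝕜 := ℝ) A) := by
    intro A
    by_cases hA : IsUnit A
    · have h := hA.map (Matrix.toEuclideanCLM (𝕜 := ℝ))
      refine h.mul_left_cancel ?_
      rw [Ring.mul_inverse_cancel _ h, ← map_mul,
        Matrix.mul_nonsing_inv _ ((Matrix.isUnit_iff_isUnit_det A).1 hA), map_one]
    · rw [Matrix.nonsing_inv_eq_ringInverse, Ring.inverse_non_unit _ hA, map_zero,
        Ring.inverse_non_unit]
      intro h
      exact hA ((isUnit_map_iff (Matrix.toEuclideanCLM (𝕜 := ℝ)) A).1 h)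
  simp only [hinv]
  obtain ⟨u, hu⟩ : IsUnit (Matrix.toEuclideanCLM (𝕜 := ℝ) (metricMatrix R φ x)) :=
    (posDef_metricMatrix R hφ hx).isUnit.map _
  have h2 := contDiffAt_ringInverse ℝ (n := 1) u
  rw [hu] at h2
  exact h2.comp x h1

theorem contDiffAt_gradient {F : Coord d → ℝ} {x : Coord d} (hF : ContDiffAt ℝ 2 F x) :
    ContDiffAt ℝ 1 (∇ F) x :=
  ((InnerProductSpace.toDual ℝ (Coord d)).symm.contDiff.contDiffAt).comp x
    (hF.fderiv_right (m := 1) (by norm_num))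

theorem hessianMatrix_isSymm {F : Coord d → ℝ} {x : Coord d} (hF : ContDiffAt ℝ 2 F x) :
    (hessianMatrix F x).IsSymm := by
  ext i j
  exact (hF.isSymmSndFDerivAt (by simp)) _ _

theorem hasFDerivAt_gradient {F : Coord d → ℝ} {x : Coord d} (hF : ContDiffAt ℝ 2 F x) :
    HasFDerivAt (∇ F) (Matrix.toEuclideanCLM (𝕜 := ℝ) (hessianMatrix F x)) x := by
  have h1 : HasFDerivAt (fderiv ℝ F) (fderiv ℝ (fderiv ℝ F) x) x :=
    ((hF.fderiv_right (m := 1) (by norm_num)).differentiableAt one_ne_zero).hasFDerivAt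
  have h2 := (InnerProductSpace.toDual ℝ (Coord d)).symm.toContinuousLinearEquiv.hasFDerivAt.comp
    x h1
  refine h2.congr_fderiv ?_
  ext v i
  have h3 : ∀ T : StrongDual ℝ (Coord d), ((InnerProductSpace.toDual ℝ (Coord d)).symm T) i =
      T (EuclideanSpace.single i 1) := by
    intro T
    rw [← InnerProductSpace.toDual_symm_apply, real_inner_comm]
    simp [EuclideanSpace.inner_single_left]
  rw [Matrix.ofLp_toEuclideanCLM]
  refine (h3 (fderiv ℝ (fderiv ℝ F) x v)).trans ?_
  -- The direction of differentiation is the first slot, while `mulVec` contracts the second index.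
  rw [(hF.isSymmSndFDerivAt (by simp)).eq v]
  conv_lhs => rw [eq_sum_smul_single v]
  simp only [map_sum, map_smul, smul_eq_mul, Matrix.mulVec, dotProduct, hessianMatrix,
    Matrix.of_apply, mul_comm]

/-- The coordinate expression of the Riemannian gradient of `f`. -/
noncomputable def riemannianGradient (R : Metric d M) (f : M → ℝ)
    (φ : OpenPartialHomeomorph M (Coord d)) (x : Coord d) : Coord d :=
  Matrix.toEuclideanCLM (𝕜 := ℝ) (metricMatrix R φ x)⁻¹ (∇ (coordFun φ f) x)

theorem contDiffAt_riemannianGradient (R : Metric d M)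
    (hφ : φ ∈ IsManifold.maximalAtlas (𝓡 d) 2 M) {f : M → ℝ}
    (hf : ContMDiff (𝓡 d) 𝓘(ℝ, ℝ) 2 f) {x : Coord d} (hx : x ∈ φ.target) :
    ContDiffAt ℝ 1 (riemannianGradient R f φ) x :=
  (contDiffAt_toEuclideanCLM_inv_metricMatrix R hφ hx).clm_apply
    (contDiffAt_gradient (contDiffAt_coordFun hφ hf hx))

/-- By the product rule, the term differentiating the inverse metric is applied to the gradient,
which vanishes at `z`. -/
theorem hasFDerivAt_riemannianGradient (R : Metric d M)
    (hφ : φ ∈ IsManifold.maximalAtlas (𝓡 d) 2 M) {f : M → ℝ}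
    (hf : ContMDiff (𝓡 d) 𝓘(ℝ, ℝ) 2 f) {z : Coord d} (hz : z ∈ φ.target)
    (hcrit : ∇ (coordFun φ f) z = 0) :
    HasFDerivAt (riemannianGradient R f φ) (Matrix.toEuclideanCLM (𝕜 := ℝ)
      ((metricMatrix R φ z)⁻¹ * hessianMatrix (coordFun φ f) z)) z := by
  have h1 := ((contDiffAt_toEuclideanCLM_inv_metricMatrix R hφ hz).differentiableAt
    one_ne_zero).hasFDerivAt
  have h2 := h1.clm_apply (hasFDerivAt_gradient (contDiffAt_coordFun hφ hf hz))
  refine h2.congr_fderiv ?_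
  ext1 v
  simp [hcrit]

theorem step_eq (R : Metric d M) (f : M → ℝ) (φ : OpenPartialHomeomorph M (Coord d)) (a : ℝ) :
    step R f φ a = fun x => x - a • riemannianGradient R f φ x := rfl

theorem step_eq_self (R : Metric d M) {f : M → ℝ} {z : Coord d}
    (hcrit : ∇ (coordFun φ f) z = 0) (a : ℝ) : step R f φ a z = z := by
  simp [step, hcrit]

theorem contDiffAt_step (R : Metric d M)
    (hφ : φ ∈ IsManifold.maximalAtlas (𝓡 d) 2 M) {f : M → ℝ}
    (hf : ContMDiff (𝓡 d) 𝓘(ℝ, ℝ) 2 f) (a : ℝ) {x : Coord d} (hx : x ∈ φ.target) :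
    ContDiffAt ℝ 1 (step R f φ a) x :=
  contDiffAt_id.sub ((contDiffAt_riemannianGradient R hφ hf hx).const_smul a)

theorem hasFDerivAt_step (R : Metric d M)
    (hφ : φ ∈ IsManifold.maximalAtlas (𝓡 d) 2 M) {f : M → ℝ}
    (hf : ContMDiff (𝓡 d) 𝓘(ℝ, ℝ) 2 f) {z : Coord d} (hz : z ∈ φ.target)
    (hcrit : ∇ (coordFun φ f) z = 0) (a : ℝ) :
    HasFDerivAt (step R f φ a) (Matrix.toEuclideanCLM (𝕜 := ℝ)
      (1 - a • ((metricMatrix R φ z)⁻¹ * hessianMatrix (coordFun φ f) z))) z := by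
  refine ((hasFDerivAt_id z).sub
    ((hasFDerivAt_riemannianGradient R hφ hf hz hcrit).const_smul a)).congr_fderiv ?_
  rw [map_sub, map_one, map_smul]
  rfl

end Coordinates

/-! ### The stable set is null. -/

section StableSet

variable {d : ℕ} {M : Type*} [TopologicalSpace M] [ChartedSpace (Coord d) M]
  [IsManifold (𝓡 d) 2 M] {φ : OpenPartialHomeomorph M (Coord d)}

theorem not_summable_of_one_div_isBigO {α : ℕ → ℝ}
    (h : (fun k : ℕ => 1 / (k : ℝ)) =O[atTop] α) : ¬ Summable α := fun hs =>
  Real.not_summable_one_div_natCast (summable_of_isBigO_nat hs h)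

/-- Induction with `N` arbitrary: the last step pulls `N` back to a null set, to which the
hypothesis for `m` applies. -/
theorem volume_orbit_preimage_eq_zero (R : Metric d M)
    (hφ : φ ∈ IsManifold.maximalAtlas (𝓡 d) 2 M) {f : M → ℝ}
    (hf : ContMDiff (𝓡 d) 𝓘(ℝ, ℝ) 2 f) {α : ℕ → ℝ}
    (hnondeg : ∀ k, ∀ᵐ x ∂(volume.restrict φ.target), (fderiv ℝ (step R f φ (α k)) x).det ≠ 0)
    (m : ℕ) {N : Set (Coord d)} (hN : volume N = 0) :
    volume {x₀ | (∀ k, orbit R f φ α x₀ k ∈ φ.target) ∧ orbit R f φ α x₀ m ∈ N} = 0 := by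
  induction m generalizing N with
  | zero => exact measure_mono_null (fun x hx => hx.2) hN
  | succ m ih =>
    have h := addHaar_preimage_eq_zero volume φ.open_target
      (fun x hx => contDiffAt_step R hφ hf (α m) hx) (hnondeg m) hN
    exact measure_mono_null (fun x (hx : _ ∧ _) => And.intro hx.1 ⟨hx.1 m, hx.2⟩) (ih h)

theorem exists_linearization_at_strictSaddle (R : Metric d M)
    (hφ : φ ∈ IsManifold.maximalAtlas (𝓡 d) 2 M) {f : M → ℝ}
    (hf : ContMDiff (𝓡 d) 𝓘(ℝ, ℝ) 2 f) {z : Coord d} (hz : z ∈ strictSaddles f φ) :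
    ∃ A H S : Matrix (Fin d) (Fin d) ℝ, A = metricMatrix R φ z ∧
      H = hessianMatrix (coordFun φ f) z ∧ S.PosDef ∧ S * S = A ∧ H.IsSymm ∧
      ∃ (Q : Matrix (Fin d) (Fin d) ℝ) (l : Fin d → ℝ),
        IsUnit Q.det ∧ Q * (A⁻¹ * H) * Q⁻¹ = Matrix.diagonal l ∧ ∃ i, l i < 0 := by
  obtain ⟨S, hS, hSA⟩ := exists_posDef_sqrt (posDef_metricMatrix R hφ hz.1)
  have hH := hessianMatrix_isSymm (contDiffAt_coordFun hφ hf hz.1)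
  exact ⟨_, _, S, rfl, rfl, hS, hSA, hH, exists_diagonalization_inv_mul hS hSA hH hz.2.2⟩

theorem volume_stableSet_eq_zero (R : Metric d M)
    (hφ : φ ∈ IsManifold.maximalAtlas (𝓡 d) 2 M) {f : M → ℝ}
    (hf : ContMDiff (𝓡 d) 𝓘(ℝ, ℝ) 2 f)
    {α : ℕ → ℝ} (hα_pos : ∀ k, 0 < α k) (hα_zero : Tendsto α atTop (𝓝 0))
    (hα_sum : ¬ Summable α)
    (hnondeg : ∀ k, ∀ᵐ x ∂(volume.restrict φ.target),
      (fderiv ℝ (step R f φ (α k)) x).det ≠ 0) :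
    volume (stableSet R f φ α) = 0 := by
  have hloc : ∀ z ∈ strictSaddles f φ, ∃ V ∈ 𝓝 z, ∃ K, ∀ m ≥ K,
      volume {y | ∃ x : ℕ → Coord d, x 0 = y ∧ ∀ k, x k ∈ V ∧
        x (k + 1) = x k - α (m + k) • riemannianGradient R f φ (x k)} = 0 := by
    intro z hz
    obtain ⟨A, H, S, rfl, rfl, -, -, -, Q, l, hQ, hdiag, i, hi⟩ :=
      exists_linearization_at_strictSaddle R hφ hf hz
    have hG := (contDiffAt_riemannianGradient R hφ hf hz.1).hasStrictFDerivAt'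
      (hasFDerivAt_riemannianGradient R hφ hf hz.1 hz.2.1) one_ne_zero
    exact exists_nhds_trapped_null volume hG (matrixCoords Q hQ) l
      (matrixCoords_toEuclideanCLM hQ hdiag) hi hα_pos hα_zero hα_sum
  choose! V hV K hK using hloc
  obtain ⟨t, hts, htc, hcov⟩ := TopologicalSpace.countable_cover_nhdsWithin
    (f := fun z => interior (V z)) (s := strictSaddles f φ)
    fun z hz => mem_nhdsWithin_of_mem_nhds (interior_mem_nhds.2 (hV z hz))
  -- The limit `w` need not be the centre `z`: only the tail staying in `V z` matters. The offset `K
  -- z` ensures that the steps are already small.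
  refine measure_mono_null (t := ⋃ z ∈ t, ⋃ m : ℕ, {x₀ | (∀ k, orbit R f φ α x₀ k ∈ φ.target) ∧
      orbit R f φ α x₀ (K z + m) ∈ {y | ∃ x : ℕ → Coord d, x 0 = y ∧ ∀ k, x k ∈ V z ∧
        x (k + 1) = x k - α (K z + m + k) • riemannianGradient R f φ (x k)}}) ?_ ?_
  · rintro x₀ ⟨htar, w, hw, hlim⟩
    obtain ⟨z, hz, hwz⟩ := mem_iUnion₂.1 (hcov hw)
    obtain ⟨m, hm⟩ := eventually_atTop.1
      (hlim.eventually_mem (isOpen_interior.mem_nhds hwz))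
    refine mem_iUnion₂.2 ⟨z, hz, mem_iUnion.2 ⟨m, htar, fun k => orbit R f φ α x₀ (K z + m + k),
      rfl, fun k => ⟨interior_subset (hm _ (by omega)), rfl⟩⟩⟩
  · exact (measure_biUnion_null_iff htc).2 fun z hz => measure_iUnion_null fun m =>
      volume_orbit_preimage_eq_zero R hφ hf hnondeg _ (hK z (hts hz) _ (by omega))

theorem riemannianMeasure_image_eq_zero [MeasurableSpace M] [BorelSpace M] (R : Metric d M)
    {W : Set (Coord d)} (hW : volume W = 0) (hWt : W ⊆ φ.target) :
    riemannianMeasure R φ (φ.symm '' W) = 0 := by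
  classical
  set N := toMeasurable volume W ∩ φ.target
  have hN : MeasurableSet N := (measurableSet_toMeasurable _ _).inter φ.open_target.measurableSet
  have hN0 : volume N = 0 :=
    measure_mono_null inter_subset_left ((measure_toMeasurable W).trans hW)
  have himg : φ.symm '' W ⊆ φ.source ∩ φ ⁻¹' N := by
    rintro _ ⟨x, hx, rfl⟩
    refine ⟨φ.map_target (hWt hx), ?_⟩
    rw [mem_preimage, φ.right_inv (hWt hx)]
    exact ⟨subset_toMeasurable _ _ hx, hWt hx⟩
  have hmeas : MeasurableSet (φ.source ∩ φ ⁻¹' N) := by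
    have h := φ.continuousOn.measurable_piecewise (g := fun _ => (0 : Coord d)) continuousOn_const
      φ.open_source.measurableSet
    have h2 : φ.source ∩ φ ⁻¹' N = φ.source ∩ φ.source.piecewise φ (fun _ => 0) ⁻¹' N := by
      ext y
      exact and_congr_right fun hy => by simp [hy]
    rw [h2]
    exact φ.open_source.measurableSet.inter (h hN)
  set ν := (volume.restrict φ.target).withDensity fun x => ENNReal.ofReal √(metricMatrix R φ x).det
  have hac : ν ≪ volume.restrict φ.target := withDensity_absolutelyContinuous _ _
  -- Needed to evaluate `Measure.map`, since `φ.symm` is only known to be continuous on the target.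
  have hsymm : AEMeasurable φ.symm ν :=
    (φ.continuousOn_symm.aemeasurable φ.open_target.measurableSet).mono_ac hac
  refine measure_mono_null himg ?_
  rw [riemannianMeasure, Measure.map_apply_of_aemeasurable hsymm hmeas]
  refine hac ?_
  rw [Measure.restrict_apply' φ.open_target.measurableSet]
  refine measure_mono_null ?_ hN0
  rintro x ⟨⟨-, hx⟩, hxt⟩
  rwa [mem_preimage, φ.right_inv hxt] at hx

end StableSet

end IntrinsicGD

theorem theorem5p5 {d : ℕ} {M : Type*} [TopologicalSpace M]
    [ChartedSpace (IntrinsicGD.Coord d) M] [IsManifold (𝓡 d) 2 M]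
    [MeasurableSpace M] [BorelSpace M]
    (R : IntrinsicGD.Metric d M)
    (f : M → ℝ) (hf : ContMDiff (𝓡 d) 𝓘(ℝ, ℝ) 2 f)
    (φ : OpenPartialHomeomorph M (IntrinsicGD.Coord d))
    (hφ : φ ∈ IsManifold.maximalAtlas (𝓡 d) 2 M)
    (α : ℕ → ℝ) (hα_pos : ∀ k, 0 < α k) (hα_zero : Tendsto α atTop (𝓝 0))
    (hα_omega : (fun k : ℕ => 1 / (k : ℝ)) =O[atTop] α)
    (hnondeg : ∀ k, ∀ᵐ x ∂(volume.restrict φ.target),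
      (fderiv ℝ (IntrinsicGD.step R f φ (α k)) x).det ≠ 0) :
    -- the stable set of the strict saddle points is null, in coordinates and on the manifold
    volume (IntrinsicGD.stableSet R f φ α) = 0 ∧
    IntrinsicGD.riemannianMeasure R φ (φ.symm '' IntrinsicGD.stableSet R f φ α) = 0 ∧
    -- the linearization at each strict saddle point
    ∀ z ∈ IntrinsicGD.strictSaddles f φ,
      ∃ A H S : Matrix (Fin d) (Fin d) ℝ,
        A = IntrinsicGD.metricMatrix R φ z ∧
        H = IntrinsicGD.hessianMatrix (IntrinsicGD.coordFun φ f) z ∧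
        -- `S` is the positive definite square root of the metric matrix
        S.PosDef ∧ S * S = A ∧
        (∀ k, IntrinsicGD.step R f φ (α k) z = z ∧
          HasFDerivAt (IntrinsicGD.step R f φ (α k))
            (Matrix.toEuclideanCLM (𝕜 := ℝ) (1 - α k • (A⁻¹ * H))) z) ∧
        S * (A⁻¹ * H) * S⁻¹ = S⁻¹ * H * S⁻¹ ∧
        (S⁻¹ * H * S⁻¹).IsSymm ∧
        ∃ (Q : Matrix (Fin d) (Fin d) ℝ) (l : Fin d → ℝ),
          IsUnit Q.det ∧ Q * (A⁻¹ * H) * Q⁻¹ = Matrix.diagonal l ∧ ∃ i, l i < 0 := by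
  have hvol := IntrinsicGD.volume_stableSet_eq_zero R hφ hf hα_pos hα_zero
    (IntrinsicGD.not_summable_of_one_div_isBigO hα_omega) hnondeg
  refine ⟨hvol, IntrinsicGD.riemannianMeasure_image_eq_zero R hvol fun x hx => hx.1 0,
    fun z hz => ?_⟩
  obtain ⟨A, H, S, rfl, rfl, hS, hSA, hH, hQ⟩ :=
    IntrinsicGD.exists_linearization_at_strictSaddle R hφ hf hz
  have hSsymm : S.IsSymm := by
    simpa [Matrix.IsHermitian, Matrix.IsSymm] using hS.isHermitian
  exact ⟨_, _, S, rfl, rfl, hS, hSA,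
    fun k => ⟨IntrinsicGD.step_eq_self R hz.2.1 _,
      IntrinsicGD.hasFDerivAt_step R hφ hf hz.1 hz.2.1 _⟩,
    IntrinsicGD.conj_sqrt_mul_inv hS hSA, IntrinsicGD.isSymm_inv_mul_mul_inv hSsymm hH, hQ⟩
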